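/- For $k\ge 1$ let $\Omega_k$ be the set of pairs $(\boldsymbol\lambda,\boldsymbol\mu)\in\mathbb R^k\times\mathbb R^k$ with $\lambda_j\ge 0$ for all $j$, $\sum_j\lambda_j=1$ and $\mu_1<\dots<\mu_k$, and let $\mathcal S$ be the set of all probability distributions on $\mathbb R$ that are symmetric about zero. For $(\boldsymbol\lambda,\boldsymbol\mu)\in\Omega_k$ let $\Delta_k(\boldsymbol\lambda,\boldsymbol\mu)=\sum_{j}\lambda_j\delta_{\mu_j}$ be the distribution with mass $\lambda_j$ at $\mu_j$. A probability distribution $F$ on $\mathbb R$ is called $k$-identifiable if there is exactly one triple $(\boldsymbol\lambda,\boldsymbol\mu,G)\in\Omega_k\times\mathcal S$ with $F=G\star\Delta_k(\boldsymbol\lambda,\boldsymbol\mu)$, where $\star$ denotes convolution. Let $$\Omega_k^*=\{(\boldsymbol\lambda,\boldsymbol\mu)\in\Omega_k : G\star\Delta_k(\boldsymbol\lambda,\boldsymbol\mu)\text{ is }k\text{-identifiable for all }G\in\mathcal S\}.$$ **Corollary 1.** Let $(\boldsymbol\lambda,\boldsymbol\mu)\in\Omega_3$. If $\lambda_1\lambda_2\lambda_3\neq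 0$ and $(\mu_2-\mu_1)/(\mu_3-\mu_2)\notin\{\tfrac13,\tfrac12,1,2,3\}$, then $(\boldsymbol\lambda,\boldsymbol\mu)\in\Omega_3^*$. Consequently, three-component location mixtures of a symmetric distribution are almost always $3$-identifiable: the set $\Omega_3\setminus\Omega_3^*$, viewed as a subset of $\mathbb R^5$ through the coordinates $(\lambda_1,\lambda_2,\mu_1,\mu_2,\mu_3)$ (with $\lambda_3=1-\lambda_1-\lambda_2$), has Lebesgue measure zero. -/

import Mathlib

open MeasureTheory

noncomputable section

namespace SymMix

/-- The parameter space `Ω_k`: pairs `(λ, μ)` with `λ_j ≥ 0`, `∑ λ_j = 1`, `μ_1 < ⋯ < μ_k`. -/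
def Omega (k : ℕ) : Set ((Fin k → ℝ) × (Fin k → ℝ)) :=
  {θ | (∀ j, 0 ≤ θ.1 j) ∧ ∑ j, θ.1 j = 1 ∧ StrictMono θ.2}

/-- The set `𝒮` of probability distributions on `ℝ` that are symmetric about zero, that is,
invariant under the reflection `x ↦ -x`. -/
def ZeroSymmetric : Set (Measure ℝ) :=
  {G | IsProbabilityMeasure G ∧ G.map (fun x => -x) = G}

/-- The finite distribution `Δ_k(λ, μ)`, with mass `λ_j` at the point `μ_j`. -/
def Delta {k : ℕ} (θ : (Fin k → ℝ) × (Fin k → ℝ)) : Measure ℝ :=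
  ∑ j, ENNReal.ofReal (θ.1 j) • Measure.dirac (θ.2 j)

/-- The map `φ_k`, sending `(λ, μ, G)` to the location mixture `G ⋆ Δ_k(λ, μ)`. -/
def mixture {k : ℕ} (θ : (Fin k → ℝ) × (Fin k → ℝ)) (G : Measure ℝ) : Measure ℝ :=
  Measure.conv G (Delta θ)

/-- The inverse image of `F` under `φ_k`, as a subset of `Ω_k × 𝒮`. -/
def fiber (k : ℕ) (F : Measure ℝ) : Set (((Fin k → ℝ) × (Fin k → ℝ)) × Measure ℝ) :=
  {p | p.1 ∈ Omega k ∧ p.2 ∈ ZeroSymmetric ∧ mixture p.1 p.2 = F}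

/-- `F` is `k`-identifiable: it is represented by exactly one element of `Ω_k × 𝒮`. -/
def IsIdentifiable (k : ℕ) (F : Measure ℝ) : Prop :=
  ∃ p, fiber k F = {p}

/-- `Ω_k^*`: the parameters in `Ω_k` whose mixtures are `k`-identifiable for all `G ∈ 𝒮`. -/
def OmegaStar (k : ℕ) : Set ((Fin k → ℝ) × (Fin k → ℝ)) :=
  {θ | θ ∈ Omega k ∧ ∀ G ∈ ZeroSymmetric, IsIdentifiable k (mixture θ G)}

/-- The parameter with `k + 1` components and coordinates `(λ_1, …, λ_k, μ_1, …, μ_{k+1})` in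
`ℝ^(2k+1)`; the last weight is `1 - λ_1 - ⋯ - λ_k`. -/
def ofCoords {k : ℕ} (x : (Fin k → ℝ) × (Fin (k + 1) → ℝ)) :
    (Fin (k + 1) → ℝ) × (Fin (k + 1) → ℝ) :=
  (Fin.snoc (α := fun _ => ℝ) x.1 (1 - ∑ j, x.1 j), x.2)

end SymMix

end

open Filter Topology

/-! ### Balance of two distributions centred at the origin -/

namespace SymMix

/-! Suppose `G ⋆ P = H ⋆ Q` with `G`, `H` symmetric and `P`, `Q` finitely supported. The
characteristic functions of `G` and `H` are real, and nonzero near 0, so that of `P ⋆ Q⁻` is real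
near 0; by analyticity it is real everywhere, so `P ⋆ Q⁻` is symmetric
(`crossBalanced_of_mixture_eq`).

What remains is combinatorics of the differences of atoms: an unmatched mass at a nonzero difference
is a contradiction. The extreme differences force `P` and `Q` to have the same midpoint, so the
atoms may be taken as `-a, s, a` and `-b, t, b`. Matching the next largest differences gives `P = Q`
unless `s` is `0`, `± a / 2` or `± a / 3`, which are the five excluded gap ratios
(`Balanced.three_point`, `CrossBalanced.eq`). Then `G = H`, because the characteristic function of
`P` has only isolated zeros (`zeroSymmetric_eq_of_mixture_eq`). The parameters not covered lie in
finitely many hyperplanes. -/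

/-- The odd indicator of `x`: the mass that `δ_u - δ_{-u}` gives to the point `x`. -/
noncomputable def oddIndicator (x u : ℝ) : ℝ :=
  (if u = x then 1 else 0) - (if -u = x then 1 else 0)

lemma oddIndicator_neg (x u : ℝ) : oddIndicator x (-u) = -oddIndicator x u := by
  simp [oddIndicator]

lemma oddIndicator_self {x : ℝ} (hx : 0 < x) : oddIndicator x x = 1 := by
  have : ¬ -x = x := by intro h; linarith
  simp [oddIndicator, this]

lemma oddIndicator_of_ne {x u : ℝ} (h : u ≠ x) (h' : -u ≠ x) : oddIndicator x u = 0 := by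
  simp [oddIndicator, h, h']

lemma oddIndicator_of_lt {x u : ℝ} (h : -x < u) (h' : u < x) : oddIndicator x u = 0 :=
  oddIndicator_of_ne h'.ne (by intro h; linarith)

lemma oddIndicator_zero (x : ℝ) : oddIndicator x 0 = 0 := by
  simp [oddIndicator]

/-- The antisymmetric part of `P ⋆ Q⁻` vanishes, where `P` has masses `p₁, p₂, p₃` at `-a, s, a`,
`Q` has masses `q₁, q₂, q₃` at `-b, t, b`, and `Q⁻` is the reflection of `Q`. -/
def Balanced (a s p₁ p₂ p₃ b t q₁ q₂ q₃ : ℝ) : Prop :=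
  ∀ x, (p₃ * q₁ - p₁ * q₃) * oddIndicator x (a + b) + (p₃ * q₃ - p₁ * q₁) * oddIndicator x (a - b)
    - p₁ * q₂ * oddIndicator x (a + t) + p₃ * q₂ * oddIndicator x (a - t)
    + p₂ * q₁ * oddIndicator x (b + s) - p₂ * q₃ * oddIndicator x (b - s)
    + p₂ * q₂ * oddIndicator x (s - t) = 0

namespace Balanced

variable {a s p₁ p₂ p₃ b t q₁ q₂ q₃ : ℝ}

lemma reflect (h : Balanced a s p₁ p₂ p₃ b t q₁ q₂ q₃) :
    Balanced a (-s) p₃ p₂ p₁ b (-t) q₃ q₂ q₁ := by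
  intro x
  have := h x
  rw [show -s - -t = -(s - t) by ring, oddIndicator_neg]
  simp only [← sub_eq_add_neg, sub_neg_eq_add]
  linarith

lemma swap (h : Balanced a s p₁ p₂ p₃ b t q₁ q₂ q₃) :
    Balanced b t q₁ q₂ q₃ a s p₁ p₂ p₃ := by
  intro x
  have := h x
  rw [show t - s = -(s - t) by ring, show b - a = -(a - b) by ring, oddIndicator_neg,
    oddIndicator_neg, add_comm b a]
  linarith

/-- The difference `a + b` is strictly the largest, so its coefficient must vanish on its own. The
outer weights are thus proportional, and this term drops out of all later comparisons. -/
lemma extreme (h : Balanced a s p₁ p₂ p₃ b t q₁ q₂ q₃) (ha : 0 < a) (hb : 0 < b)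
    (hs : |s| < a) (ht : |t| < b) : p₃ * q₁ = p₁ * q₃ := by
  rw [abs_lt] at hs ht
  have := h (a + b)
  rw [oddIndicator_self (by linarith),
    oddIndicator_of_lt (u := a - b) (by linarith) (by linarith),
    oddIndicator_of_lt (u := a + t) (by linarith) (by linarith),
    oddIndicator_of_lt (u := a - t) (by linarith) (by linarith),
    oddIndicator_of_lt (u := b + s) (by linarith) (by linarith),
    oddIndicator_of_lt (u := b - s) (by linarith) (by linarith),
    oddIndicator_of_lt (u := s - t) (by linarith) (by linarith)] at this
  linarith

/-- A two-point `Q` forces `s = a / 3` when `s > 0`. -/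
lemma two_point (h : Balanced a s p₁ p₂ p₃ b t q₁ 0 q₃) (hb : 0 < b)
    (hs : 0 < s) (hsa : s < a) (hp₂ : 0 < p₂) (hq₁ : 0 < q₁) (hq₃ : 0 < q₃)
    (hx : p₃ * q₁ = p₁ * q₃) : s = a / 3 := by
  have hx' : p₃ * q₁ - p₁ * q₃ = 0 := by linarith
  have h₁ := mul_pos hp₂ hq₁
  have h₃ := mul_pos hp₂ hq₃
  -- The positive mass at `b + s` exceeds `|b - s|` in position, so only the term at `±(a - b)` can
  -- cancel it.
  have e : b + s = a - b ∨ b + s = b - a := by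
    by_contra! hne
    have := h (b + s)
    rw [hx', oddIndicator_self (by linarith),
      oddIndicator_of_ne (u := a - b) hne.1.symm (by intro h'; apply hne.2; linarith),
      oddIndicator_of_lt (u := b - s) (by linarith) (by linarith)] at this
    linarith
  have e : b + s = a - b := e.resolve_right (by intro h'; linarith)
  -- Now `a - b = b + s`, so nothing can cancel the mass at `b - s` unless `b = s`, and then `a = 3
  -- * s`.
  by_contra hne
  rcases lt_trichotomy b s with hbs | hbs | hbs
  · have := h (s - b)
    rw [hx', show b - s = -(s - b) by ring, oddIndicator_neg, oddIndicator_self (by linarith),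
      oddIndicator_of_ne (x := s - b) (u := a - b) (by intro h'; linarith) (by intro h'; linarith),
      oddIndicator_of_ne (x := s - b) (u := b + s) (by intro h'; linarith)
        (by intro h'; linarith)] at this
    linarith
  · exact hne (by linarith)
  · have := h (b - s)
    rw [hx', oddIndicator_self (by linarith),
      oddIndicator_of_ne (x := b - s) (u := a - b) (by intro h'; linarith) (by intro h'; linarith),
      oddIndicator_of_ne (x := b - s) (u := b + s) (by intro h'; linarith)
        (by intro h'; linarith)] at this
    linarith

/-- The wider of two three-point distributions: `a > b` and `s > 0` leave only `s = a / 2` and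
`s = a / 3`, both with `t = 0`. -/
lemma wider (h : Balanced a s p₁ p₂ p₃ b t q₁ q₂ q₃) (hs : 0 < s)
    (hsa : s < a) (ht : |t| < b) (hba : b < a) (hp₁ : 0 < p₁) (hp₂ : 0 < p₂) (hp₃ : 0 < p₃)
    (hq₁ : 0 < q₁) (hq₂ : 0 < q₂) (hq₃ : 0 < q₃) (hx : p₃ * q₁ = p₁ * q₃) :
    t = 0 ∧ (s = a / 2 ∨ s = a / 3) := by
  have hb : 0 < b := (abs_nonneg t).trans_lt ht
  rw [abs_lt] at ht
  have hx' : p₃ * q₁ - p₁ * q₃ = 0 := by linarith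
  have h₁₂ := mul_pos hp₁ hq₂
  have h₃₂ := mul_pos hp₃ hq₂
  have h₂₁ := mul_pos hp₂ hq₁
  have h₂₂ := mul_pos hp₂ hq₂
  have h₂₃ := mul_pos hp₂ hq₃
  rcases lt_trichotomy t 0 with ht0 | ht0 | ht0
  · exfalso
    -- For `t < 0` the largest remaining differences are `a - t` and `b + s`; both carry positive
    -- mass and cannot cancel.
    rcases le_or_gt (b + s) (a - t) with hle | hlt
    · have := h (a - t)
      rw [hx', oddIndicator_self (by linarith),
        oddIndicator_of_lt (u := a - b) (by linarith) (by linarith),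
        oddIndicator_of_lt (u := a + t) (by linarith) (by linarith),
        oddIndicator_of_lt (u := b - s) (by linarith) (by linarith),
        oddIndicator_of_lt (u := s - t) (by linarith) (by linarith)] at this
      rcases hle.eq_or_lt with heq | hlt
      · rw [heq, oddIndicator_self (by linarith)] at this
        linarith
      · rw [oddIndicator_of_lt (u := b + s) (by linarith) (by linarith)] at this
        linarith
    · have := h (b + s)
      rw [hx', oddIndicator_self (by linarith),
        oddIndicator_of_lt (u := a - b) (by linarith) (by linarith),
        oddIndicator_of_lt (u := a + t) (by linarith) (by linarith),
        oddIndicator_of_lt (u := a - t) (by linarith) (by linarith),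
        oddIndicator_of_lt (u := b - s) (by linarith) (by linarith),
        oddIndicator_of_lt (u := s - t) (by linarith) (by linarith)] at this
      linarith
  · subst ht0
    refine ⟨rfl, ?_⟩
    simp only [add_zero, sub_zero, Balanced] at h
    -- If `b + s > a`, the mass there is alone. If `b + s < a`, the mass at `a` forces `p₁ = p₃`,
    -- hence `q₁ = q₃`; this kills the `a - b` term and again isolates `b + s`.
    have e : b + s = a := by
      rcases lt_trichotomy (b + s) a with hlt | heq | hlt
      · exfalso
        have h1 := h a
        rw [hx', oddIndicator_self (by linarith),
          oddIndicator_of_lt (u := a - b) (by linarith) (by linarith),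
          oddIndicator_of_lt (u := b + s) (by linarith) (by linarith),
          oddIndicator_of_lt (u := b - s) (by linarith) (by linarith),
          oddIndicator_of_lt (u := s) (by linarith) (by linarith)] at h1
        have h13 : p₁ = p₃ := mul_right_cancel₀ hq₂.ne' (by linarith)
        have h13' : q₁ = q₃ := mul_left_cancel₀ hp₃.ne' (by rw [hx, h13])
        have h2 := h (b + s)
        rw [hx', oddIndicator_self (by linarith),
          oddIndicator_of_lt (u := b - s) (by linarith) (by linarith),
          oddIndicator_of_lt (u := s) (by linarith) (by linarith), h13, h13'] at h2
        rw [h13'] at h₂₁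
        linarith
      · exact heq
      · exfalso
        have := h (b + s)
        rw [hx', oddIndicator_self (by linarith),
          oddIndicator_of_lt (u := a - b) (by linarith) (by linarith),
          oddIndicator_of_lt (u := a) (by linarith) (by linarith),
          oddIndicator_of_lt (u := b - s) (by linarith) (by linarith),
          oddIndicator_of_lt (u := s) (by linarith) (by linarith)] at this
        linarith
    -- With `a - b = s`, the mass at `b - s` is harmless only if `b - s = 0`, giving `s = a / 2`, or
    -- `b - s = s`, giving `s = a / 3`.
    by_contra! hne
    rcases lt_trichotomy b s with hbs | hbs | hbs
    · have := h (s - b)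
      rw [hx', show b - s = -(s - b) by ring, oddIndicator_neg, oddIndicator_self (by linarith),
        oddIndicator_of_ne (x := s - b) (u := a - b) (by intro h'; linarith)
          (by intro h'; linarith),
        oddIndicator_of_ne (x := s - b) (u := a) (by intro h'; linarith) (by intro h'; linarith),
        oddIndicator_of_ne (x := s - b) (u := s) (by intro h'; linarith) (by intro h'; linarith),
        oddIndicator_of_ne (x := s - b) (u := b + s) (by intro h'; linarith)
          (by intro h'; linarith)] at this
      linarith
    · exact hne.1 (by linarith)
    · have := h (b - s)
      rw [hx', oddIndicator_self (by linarith),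
        oddIndicator_of_ne (x := b - s) (u := a - b)
          (by intro h'; exact hne.2 (by linarith)) (by intro h'; linarith),
        oddIndicator_of_ne (x := b - s) (u := a) (by intro h'; linarith) (by intro h'; linarith),
        oddIndicator_of_ne (x := b - s) (u := s)
          (by intro h'; exact hne.2 (by linarith)) (by intro h'; linarith),
        oddIndicator_of_ne (x := b - s) (u := b + s) (by intro h'; linarith)
          (by intro h'; linarith)] at this
      linarith
  · exfalso
    -- Here `a + t` and `b + s` compete for the largest difference with opposite signs, so they must
    -- coincide; then the mass at `a - t` is unmatched.
    rcases lt_trichotomy (b + s) (a + t) with hlt | heq | hlt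
    · have := h (a + t)
      rw [hx', oddIndicator_self (by linarith),
        oddIndicator_of_lt (u := a - b) (by linarith) (by linarith),
        oddIndicator_of_lt (u := a - t) (by linarith) (by linarith),
        oddIndicator_of_lt (u := b + s) (by linarith) (by linarith),
        oddIndicator_of_lt (u := b - s) (by linarith) (by linarith),
        oddIndicator_of_lt (u := s - t) (by linarith) (by linarith)] at this
      linarith
    · have := h (a - t)
      rw [hx', oddIndicator_self (by linarith),
        oddIndicator_of_ne (x := a - t) (u := a - b) (by intro h'; linarith)
          (by intro h'; linarith),
        oddIndicator_of_ne (x := a - t) (u := a + t) (by intro h'; linarith)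
          (by intro h'; linarith),
        oddIndicator_of_ne (x := a - t) (u := b + s) (by intro h'; linarith)
          (by intro h'; linarith),
        oddIndicator_of_lt (u := b - s) (by linarith) (by linarith),
        oddIndicator_of_ne (x := a - t) (u := s - t) (by intro h'; linarith)
          (by intro h'; linarith)] at this
      linarith
    · have := h (b + s)
      rw [hx', oddIndicator_self (by linarith),
        oddIndicator_of_lt (u := a - b) (by linarith) (by linarith),
        oddIndicator_of_lt (u := a + t) (by linarith) (by linarith),
        oddIndicator_of_lt (u := a - t) (by linarith) (by linarith),
        oddIndicator_of_lt (u := b - s) (by linarith) (by linarith),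
        oddIndicator_of_lt (u := s - t) (by linarith) (by linarith)] at this
      linarith

/-- A narrower `P` with `s > 0` is never balanced by a three-point `Q` with `t = 0`. -/
lemma not_narrower_centered (h : Balanced a s p₁ p₂ p₃ b 0 q₁ q₂ q₃) (hs : 0 < s)
    (hsa : s < a) (hab : a < b) (hp₂ : 0 < p₂) (hq₁ : 0 < q₁) (hx : p₃ * q₁ = p₁ * q₃) :
    False := by
  have hx' : p₃ * q₁ - p₁ * q₃ = 0 := by linarith
  have h₂₁ := mul_pos hp₂ hq₁
  simp only [add_zero, sub_zero, Balanced] at h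
  have := h (b + s)
  rw [hx', oddIndicator_self (by linarith),
    oddIndicator_of_lt (u := a - b) (by linarith) (by linarith),
    oddIndicator_of_lt (u := a) (by linarith) (by linarith),
    oddIndicator_of_lt (u := b - s) (by linarith) (by linarith),
    oddIndicator_of_lt (u := s) (by linarith) (by linarith)] at this
  linarith

/-- Three-point distributions of equal width with `s > 0`, `t ≤ s` and `-s ≤ t` coincide up to
scaling. -/
lemma equal_width (h : Balanced a s p₁ p₂ p₃ a t q₁ q₂ q₃) (hs : 0 < s) (hsa : s < a)
    (hts : t ≤ s) (hst : -s ≤ t) (hp₂ : 0 < p₂) (hp₃ : 0 < p₃) (hq₁ : 0 < q₁)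
    (hq₂ : 0 < q₂) (hx : p₃ * q₁ = p₁ * q₃) : t = s ∧ p₂ * q₁ = p₁ * q₂ := by
  have hx' : p₃ * q₁ - p₁ * q₃ = 0 := by linarith
  have h₂₁ := mul_pos hp₂ hq₁
  have h₃₂ := mul_pos hp₃ hq₂
  -- Since `|t| ≤ s`, no remaining difference exceeds `a + s`. Its positive mass can be cancelled
  -- only by `a + t`, as `a - t` contributes with the same sign.
  have := h (a + s)
  rw [hx', oddIndicator_self (by linarith), sub_self, oddIndicator_zero,
    oddIndicator_of_lt (u := a - s) (by linarith) (by linarith),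
    oddIndicator_of_lt (u := s - t) (by linarith) (by linarith)] at this
  rcases hts.eq_or_lt with heq | hlt
  · subst heq
    rw [oddIndicator_self (by linarith),
      oddIndicator_of_lt (u := a - t) (by linarith) (by linarith)] at this
    exact ⟨rfl, by linarith⟩
  · exfalso
    rw [oddIndicator_of_lt (u := a + t) (by linarith) (by linarith)] at this
    rcases hst.eq_or_lt with heq | hlt'
    · rw [← heq, sub_neg_eq_add, oddIndicator_self (by linarith)] at this
      linarith
    · rw [oddIndicator_of_lt (u := a - t) (by linarith) (by linarith)] at this
      linarith

lemma equal_width_of_abs_le (h : Balanced a s p₁ p₂ p₃ a t q₁ q₂ q₃) (hs0 : s ≠ 0) (hsa : |s| < a)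
    (hts : |t| ≤ |s|) (hp₁ : 0 < p₁) (hp₂ : 0 < p₂) (hp₃ : 0 < p₃) (hq₁ : 0 < q₁)
    (hq₂ : 0 < q₂) (hq₃ : 0 < q₃) (hx : p₃ * q₁ = p₁ * q₃) : t = s ∧ p₂ * q₁ = p₁ * q₂ := by
  rcases lt_or_gt_of_ne hs0 with hneg | hpos
  · rw [abs_of_neg hneg] at hsa hts
    rw [abs_le] at hts
    obtain ⟨h1, h2⟩ := h.reflect.equal_width (by linarith) hsa (by linarith) (by linarith) hp₂ hp₁
      hq₃ hq₂ hx.symm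
    refine ⟨by linarith, mul_left_cancel₀ hp₃.ne' ?_⟩
    linear_combination p₂ * hx + p₁ * h2
  · rw [abs_of_pos hpos] at hsa hts
    rw [abs_le] at hts
    exact h.equal_width hpos hsa hts.2 hts.1 hp₂ hp₃ hq₁ hq₂ hx

/-- The three-point case for `s > 0`. -/
lemma three_point_of_pos (h : Balanced a s p₁ p₂ p₃ b t q₁ q₂ q₃) (hs : 0 < s) (hsa : s < a)
    (ht : |t| < b) (hp₁ : 0 < p₁) (hp₂ : 0 < p₂) (hp₃ : 0 < p₃)
    (hq₁ : 0 < q₁) (hq₂ : 0 < q₂) (hq₃ : 0 < q₃) (h2 : s ≠ a / 2) (h3 : s ≠ a / 3) :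
    a = b ∧ s = t ∧ p₂ * q₁ = p₁ * q₂ ∧ p₃ * q₁ = p₁ * q₃ := by
  have hb : 0 < b := (abs_nonneg t).trans_lt ht
  have hsa' : |s| < a := by rwa [abs_of_pos hs]
  have hx := h.extreme (hs.trans hsa) hb hsa' ht
  rcases lt_trichotomy a b with hab | hab | hab
  · exfalso
    -- When `Q` is the wider one and `t ≠ 0`, `wider` with the roles exchanged would give `s = 0`.
    rcases lt_trichotomy t 0 with ht0 | ht0 | ht0
    · rw [abs_of_neg ht0] at ht
      have := h.swap.reflect.wider (by linarith) ht (by rwa [abs_neg]) hab hq₃ hq₂ hq₁ hp₃ hp₂ hp₁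
        (by linarith)
      linarith [this.1]
    · subst ht0
      exact h.not_narrower_centered hs hsa hab hp₂ hq₁ hx
    · rw [abs_of_pos ht0] at ht
      have := h.swap.wider ht0 ht hsa' hab hq₁ hq₂ hq₃ hp₁ hp₂ hp₃ (by linarith)
      linarith [this.1]
  · subst hab
    rcases le_total |t| |s| with hts | hst
    · obtain ⟨h1, h2⟩ := h.equal_width_of_abs_le hs.ne' hsa' hts hp₁ hp₂ hp₃ hq₁ hq₂ hq₃ hx
      exact ⟨rfl, h1.symm, h2, hx⟩
    · have ht0 : t ≠ 0 := by
        rintro rfl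
        rw [abs_zero, abs_of_pos hs] at hst
        linarith
      obtain ⟨h1, h2⟩ := h.swap.equal_width_of_abs_le ht0 ht hst hq₁ hq₂ hq₃ hp₁ hp₂ hp₃
        (by linarith)
      exact ⟨rfl, h1, by linarith, hx⟩
  · exfalso
    rcases (h.wider hs hsa ht hab hp₁ hp₂ hp₃ hq₁ hq₂ hq₃ hx).2 with h' | h'
    · exact h2 h'
    · exact h3 h'

lemma three_point (h : Balanced a s p₁ p₂ p₃ b t q₁ q₂ q₃) (hs : s ≠ 0) (hsa : |s| < a)
    (ht : |t| < b) (hp₁ : 0 < p₁) (hp₂ : 0 < p₂) (hp₃ : 0 < p₃)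
    (hq₁ : 0 < q₁) (hq₂ : 0 < q₂) (hq₃ : 0 < q₃) (h2 : |s| ≠ a / 2) (h3 : |s| ≠ a / 3) :
    a = b ∧ s = t ∧ p₂ * q₁ = p₁ * q₂ ∧ p₃ * q₁ = p₁ * q₃ := by
  rcases lt_or_gt_of_ne hs with hneg | hpos
  · rw [abs_of_neg hneg] at hsa h2 h3
    obtain ⟨e1, e2, e3, e4⟩ := h.reflect.three_point_of_pos (by linarith) hsa (by rwa [abs_neg])
      hp₃ hp₂ hp₁ hq₃ hq₂ hq₁ h2 h3
    refine ⟨e1, by linarith, mul_left_cancel₀ hp₃.ne' ?_, e4.symm⟩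
    linear_combination -p₂ * e4 + p₁ * e3
  · rw [abs_of_pos hpos] at hsa h2 h3
    exact h.three_point_of_pos hpos hsa ht hp₁ hp₂ hp₃ hq₁ hq₂ hq₃ h2 h3

lemma two_point_abs (h : Balanced a s p₁ p₂ p₃ b t q₁ 0 q₃) (hs : s ≠ 0) (hsa : |s| < a)
    (ht : |t| < b) (hp₂ : 0 < p₂) (hq₁ : 0 < q₁) (hq₃ : 0 < q₃) : |s| = a / 3 := by
  have hb : 0 < b := (abs_nonneg t).trans_lt ht
  have hx := h.extreme ((abs_nonneg s).trans_lt hsa) hb hsa ht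
  rcases lt_or_gt_of_ne hs with hneg | hpos
  · rw [abs_of_neg hneg] at hsa ⊢
    exact h.reflect.two_point hb (by linarith) hsa hp₂ hq₃ hq₁ hx.symm
  · rw [abs_of_pos hpos] at hsa ⊢
    exact h.two_point hb hpos hsa hp₂ hq₁ hq₃ hx

end Balanced

end SymMix

/-! ### Reduction of general supports to the centred case -/

namespace SymMix

/-- The antisymmetric part of `P ⋆ Q⁻` vanishes, where `P` has masses `p i` at `m i`, `Q` has
masses `q j` at `n j`, and `Q⁻` is the reflection of `Q`. -/
def CrossBalanced {k l : ℕ} (p m : Fin k → ℝ) (q n : Fin l → ℝ) : Prop :=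
  ∀ x, ∑ i, ∑ j, p i * q j * oddIndicator x (m i - n j) = 0

section Combinatorics

variable {p m : Fin 3 → ℝ} {c₁ c₂ c₃ n₁ n₂ n₃ : ℝ}

/-- Otherwise `m 2 - n₁` exceeds every other difference in absolute value, and its positive mass is
unmatched. `center_le` is the mirror image. -/
lemma CrossBalanced.le_center (h : CrossBalanced p m ![c₁, c₂, c₃] ![n₁, n₂, n₃])
    (hp : ∀ i, 0 < p i) (hm : StrictMono m) (hc₁ : 0 < c₁) (h₁₂ : n₁ < n₂) (h₂₃ : n₂ < n₃) :
    m 0 + m 2 ≤ n₁ + n₃ := by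
  have h01 : m 0 < m 1 := hm (by decide)
  have h12 : m 1 < m 2 := hm (by decide)
  by_contra! hlt
  have := h (m 2 - n₁)
  simp only [Fin.sum_univ_three, Matrix.cons_val] at this
  rw [oddIndicator_self (by linarith),
    oddIndicator_of_lt (u := m 0 - n₁) (by linarith) (by linarith),
    oddIndicator_of_lt (u := m 0 - n₂) (by linarith) (by linarith),
    oddIndicator_of_lt (u := m 0 - n₃) (by linarith) (by linarith),
    oddIndicator_of_lt (u := m 1 - n₁) (by linarith) (by linarith),
    oddIndicator_of_lt (u := m 1 - n₂) (by linarith) (by linarith),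
    oddIndicator_of_lt (u := m 1 - n₃) (by linarith) (by linarith),
    oddIndicator_of_lt (u := m 2 - n₂) (by linarith) (by linarith),
    oddIndicator_of_lt (u := m 2 - n₃) (by linarith) (by linarith)] at this
  linarith [mul_pos (hp 2) hc₁]

lemma CrossBalanced.center_le (h : CrossBalanced p m ![c₁, c₂, c₃] ![n₁, n₂, n₃])
    (hp : ∀ i, 0 < p i) (hm : StrictMono m) (hc₃ : 0 < c₃) (h₁₂ : n₁ < n₂) (h₂₃ : n₂ < n₃) :
    n₁ + n₃ ≤ m 0 + m 2 := by
  have h01 : m 0 < m 1 := hm (by decide)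
  have h12 : m 1 < m 2 := hm (by decide)
  by_contra! hlt
  have := h (n₃ - m 0)
  simp only [Fin.sum_univ_three, Matrix.cons_val] at this
  rw [← neg_sub n₃ (m 0), oddIndicator_neg, oddIndicator_self (by linarith),
    oddIndicator_of_lt (u := m 0 - n₁) (by linarith) (by linarith),
    oddIndicator_of_lt (u := m 0 - n₂) (by linarith) (by linarith),
    oddIndicator_of_lt (u := m 1 - n₁) (by linarith) (by linarith),
    oddIndicator_of_lt (u := m 1 - n₂) (by linarith) (by linarith),
    oddIndicator_of_lt (u := m 1 - n₃) (by linarith) (by linarith),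
    oddIndicator_of_lt (u := m 2 - n₁) (by linarith) (by linarith),
    oddIndicator_of_lt (u := m 2 - n₂) (by linarith) (by linarith),
    oddIndicator_of_lt (u := m 2 - n₃) (by linarith) (by linarith)] at this
  linarith [mul_pos (hp 0) hc₃]

/-- Two balanced distributions share the midpoint of their supports, and translating it to the
origin gives the normalized form of the balance. -/
lemma CrossBalanced.balanced (h : CrossBalanced p m ![c₁, c₂, c₃] ![n₁, n₂, n₃])
    (hc : m 0 + m 2 = n₁ + n₃) :
    Balanced ((m 2 - m 0) / 2) (m 1 - (m 0 + m 2) / 2) (p 0) (p 1) (p 2)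
      ((n₃ - n₁) / 2) (n₂ - (m 0 + m 2) / 2) c₁ c₂ c₃ := by
  intro x
  have := h x
  simp only [Fin.sum_univ_three, Matrix.cons_val] at this
  rw [show m 0 - n₁ = -((m 2 - m 0) / 2 - (n₃ - n₁) / 2) by linarith,
    show m 0 - n₂ = -((m 2 - m 0) / 2 + (n₂ - (m 0 + m 2) / 2)) by linarith,
    show m 0 - n₃ = -((m 2 - m 0) / 2 + (n₃ - n₁) / 2) by linarith,
    show m 1 - n₁ = (n₃ - n₁) / 2 + (m 1 - (m 0 + m 2) / 2) by linarith,
    show m 1 - n₂ = (m 1 - (m 0 + m 2) / 2) - (n₂ - (m 0 + m 2) / 2) by linarith,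
    show m 1 - n₃ = -((n₃ - n₁) / 2 - (m 1 - (m 0 + m 2) / 2)) by linarith,
    show m 2 - n₁ = (m 2 - m 0) / 2 + (n₃ - n₁) / 2 by linarith,
    show m 2 - n₂ = (m 2 - m 0) / 2 - (n₂ - (m 0 + m 2) / 2) by linarith,
    show m 2 - n₃ = (m 2 - m 0) / 2 - (n₃ - n₁) / 2 by linarith] at this
  simp only [oddIndicator_neg] at this
  linarith

lemma CrossBalanced.three_point (h : CrossBalanced p m ![c₁, c₂, c₃] ![n₁, n₂, n₃])
    (hp : ∀ i, 0 < p i) (hm : StrictMono m)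
    (hr : (m 1 - m 0) / (m 2 - m 1) ∉ ({1 / 3, 1 / 2, 1, 2, 3} : Set ℝ))
    (hc₁ : 0 < c₁) (hc₂ : 0 ≤ c₂) (hc₃ : 0 < c₃) (h₁₂ : n₁ < n₂) (h₂₃ : n₂ < n₃) :
    0 < c₂ ∧ (m 0 = n₁ ∧ m 1 = n₂ ∧ m 2 = n₃) ∧ p 1 * c₁ = p 0 * c₂ ∧ p 2 * c₁ = p 0 * c₃ := by
  have h01 : m 0 < m 1 := hm (by decide)
  have h12 : m 1 < m 2 := hm (by decide)
  have hc := le_antisymm (h.le_center hp hm hc₁ h₁₂ h₂₃) (h.center_le hp hm hc₃ h₁₂ h₂₃)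
  have hb := h.balanced hc
  have h0 : (0 : ℝ) < m 2 - m 1 := by linarith
  simp only [Set.mem_insert_iff, Set.mem_singleton_iff, div_eq_iff h0.ne', not_or] at hr
  obtain ⟨r1, r2, r3, r4, r5⟩ := hr
  -- The gap ratio is `(a + s) / (a - s)`, so the values 1/3, 1/2, 1, 2, 3 correspond to `s / a`
  -- being -1/2, -1/3, 0, 1/3, 1/2.
  have hs : m 1 - (m 0 + m 2) / 2 ≠ 0 := fun e ↦ r3 (by linarith)
  have hsa : |m 1 - (m 0 + m 2) / 2| < (m 2 - m 0) / 2 := by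
    rw [abs_lt]; constructor <;> linarith
  have ht : |n₂ - (m 0 + m 2) / 2| < (n₃ - n₁) / 2 := by
    rw [abs_lt]; constructor <;> linarith
  have hs2 : |m 1 - (m 0 + m 2) / 2| ≠ (m 2 - m 0) / 2 / 2 := by
    intro e
    rcases eq_or_eq_neg_of_abs_eq e with e | e
    · exact r5 (by linarith)
    · exact r1 (by linarith)
  have hs3 : |m 1 - (m 0 + m 2) / 2| ≠ (m 2 - m 0) / 2 / 3 := by
    intro e
    rcases eq_or_eq_neg_of_abs_eq e with e | e
    · exact r4 (by linarith)
    · exact r2 (by linarith)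
  rcases hc₂.eq_or_lt with e | hc₂
  · subst e
    exact absurd (hb.two_point_abs hs hsa ht (hp 1) hc₁ hc₃) hs3
  · obtain ⟨e1, e2, e3, e4⟩ :=
      hb.three_point hs hsa ht (hp 0) (hp 1) (hp 2) hc₁ hc₂ hc₃ hs2 hs3
    exact ⟨hc₂, ⟨by linarith, by linarith, by linarith⟩, e3, e4⟩

lemma CrossBalanced.not_two_point {u v α β : ℝ} (h : CrossBalanced p m ![α, β] ![u, v])
    (hp : ∀ i, 0 < p i) (hm : StrictMono m)
    (hr : (m 1 - m 0) / (m 2 - m 1) ∉ ({1 / 3, 1 / 2, 1, 2, 3} : Set ℝ))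
    (hα : 0 < α) (hβ : 0 < β) (huv : u < v) : False := by
  -- A middle atom of weight zero makes the three-point lemma applicable; its conclusion that this
  -- weight is positive is the contradiction.
  have h' : CrossBalanced p m ![α, 0, β] ![u, (u + v) / 2, v] := by
    intro x
    have := h x
    simp only [Fin.sum_univ_three, Fin.sum_univ_two, Matrix.cons_val] at this ⊢
    linarith
  exact lt_irrefl _ (h'.three_point hp hm hr hα le_rfl hβ (by linarith) (by linarith)).1

/-- Balance against a point mass makes `P` symmetric about `u`, which puts its middle atom at `u`
and makes the gap ratio 1. -/
lemma CrossBalanced.not_one_point {u α : ℝ} (h : CrossBalanced p m ![α] ![u])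
    (hp : ∀ i, 0 < p i) (hm : StrictMono m)
    (hr : (m 1 - m 0) / (m 2 - m 1) ∉ ({1 / 3, 1 / 2, 1, 2, 3} : Set ℝ))
    (hα : 0 < α) : False := by
  have h01 : m 0 < m 1 := hm (by decide)
  have h12 : m 1 < m 2 := hm (by decide)
  simp only [CrossBalanced, Fin.sum_univ_three, Fin.sum_univ_one, Matrix.cons_val] at h
  have h0 := mul_pos (hp 0) hα
  have h1 := mul_pos (hp 1) hα
  have h2 := mul_pos (hp 2) hα
  have hc : m 0 + m 2 = 2 * u := by
    rcases lt_trichotomy (m 0 + m 2) (2 * u) with hlt | heq | hlt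
    · exfalso
      have := h (u - m 0)
      rw [← neg_sub u (m 0), oddIndicator_neg, oddIndicator_self (by linarith),
        oddIndicator_of_lt (u := m 1 - u) (by linarith) (by linarith),
        oddIndicator_of_lt (u := m 2 - u) (by linarith) (by linarith)] at this
      linarith
    · exact heq
    · exfalso
      have := h (m 2 - u)
      rw [oddIndicator_self (by linarith),
        oddIndicator_of_lt (u := m 1 - u) (by linarith) (by linarith),
        oddIndicator_of_lt (u := m 0 - u) (by linarith) (by linarith)] at this
      linarith
  rcases lt_trichotomy (m 1) u with hlt | heq | hlt
  · have := h (u - m 1)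
    rw [← neg_sub u (m 1), oddIndicator_neg, oddIndicator_self (by linarith),
      oddIndicator_of_ne (x := u - m 1) (u := m 0 - u) (by intro e; linarith)
        (by intro e; linarith),
      oddIndicator_of_ne (x := u - m 1) (u := m 2 - u) (by intro e; linarith)
        (by intro e; linarith)] at this
    linarith
  · apply hr
    have e : m 1 - m 0 = m 2 - m 1 := by linarith
    rw [e, div_self (by linarith)]
    simp
  · have := h (m 1 - u)
    rw [oddIndicator_self (by linarith),
      oddIndicator_of_ne (x := m 1 - u) (u := m 0 - u) (by intro e; linarith)
        (by intro e; linarith),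
      oddIndicator_of_ne (x := m 1 - u) (u := m 2 - u) (by intro e; linarith)
        (by intro e; linarith)] at this
    linarith

/-- A three-point distribution whose gap ratio is not exceptional is balanced only by itself. -/
theorem CrossBalanced.eq {q n : Fin 3 → ℝ} (h : CrossBalanced p m q n) (hpm : (p, m) ∈ Omega 3)
    (hp : ∀ i, 0 < p i)
    (hr : (m 1 - m 0) / (m 2 - m 1) ∉ ({1 / 3, 1 / 2, 1, 2, 3} : Set ℝ))
    (hqn : (q, n) ∈ Omega 3) : q = p ∧ n = m := by
  obtain ⟨-, hp1, hm⟩ := hpm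
  obtain ⟨hq, hq1, hn⟩ := hqn
  dsimp only at hp1 hm hq hq1 hn
  have h01 : n 0 < n 1 := hn (by decide)
  have h12 : n 1 < n 2 := hn (by decide)
  rw [Fin.sum_univ_three] at hp1 hq1
  have h3 : CrossBalanced p m ![q 0, q 1, q 2] ![n 0, n 1, n 2] := by
    intro x
    simpa [Fin.sum_univ_three] using h x
  simp only [CrossBalanced, Fin.sum_univ_three] at h
  -- `Omega` allows zero weights, so `q` may have fewer than three atoms.
  rcases (hq 0).eq_or_lt' with e0 | p0 <;> rcases (hq 2).eq_or_lt' with e2 | p2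
  · refine (CrossBalanced.not_one_point (u := n 1) (α := q 1) (fun x ↦ ?_) hp hm hr
      (by linarith)).elim
    simpa [Fin.sum_univ_three, e0, e2] using h x
  · rcases (hq 1).eq_or_lt' with e1 | p1
    · refine (CrossBalanced.not_one_point (u := n 2) (α := q 2) (fun x ↦ ?_) hp hm hr p2).elim
      simpa [Fin.sum_univ_three, e0, e1] using h x
    · refine (CrossBalanced.not_two_point (u := n 1) (v := n 2) (α := q 1) (β := q 2)
        (fun x ↦ ?_) hp hm hr p1 p2 h12).elim
      simpa [Fin.sum_univ_three, e0] using h x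
  · rcases (hq 1).eq_or_lt' with e1 | p1
    · refine (CrossBalanced.not_one_point (u := n 0) (α := q 0) (fun x ↦ ?_) hp hm hr p0).elim
      simpa [Fin.sum_univ_three, e1, e2] using h x
    · refine (CrossBalanced.not_two_point (u := n 0) (v := n 1) (α := q 0) (β := q 1)
        (fun x ↦ ?_) hp hm hr p0 p1 h01).elim
      simpa [Fin.sum_univ_three, e2] using h x
  · obtain ⟨-, ⟨e0, e1, e2⟩, f1, f2⟩ := h3.three_point hp hm hr p0 (hq 1) p2 h01 h12
    -- The weights are proportional and both sum to 1.
    have g0 : q 0 = p 0 := by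
      linear_combination (-q 0) * hp1 + p 0 * hq1 + f1 + f2
    have hne := (hp 0).ne'
    rw [g0, mul_comm] at f1 f2
    refine ⟨funext fun i ↦ ?_, funext fun i ↦ ?_⟩
    · fin_cases i
      · exact g0
      · exact (mul_left_cancel₀ hne f1).symm
      · exact (mul_left_cancel₀ hne f2).symm
    · fin_cases i
      · exact e0.symm
      · exact e1.symm
      · exact e2.symm

end Combinatorics

end SymMix

/-! ### Characteristic functions -/

namespace SymMix

lemma integral_sum_dirac {ι E : Type*} [Fintype ι] [NormedAddCommGroup E] [NormedSpace ℝ E]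
    [CompleteSpace E] (w u : ι → ℝ) (hw : ∀ i, 0 ≤ w i) (f : ℝ → E) :
    ∫ x, f x ∂(∑ i, ENNReal.ofReal (w i) • Measure.dirac (u i)) = ∑ i, w i • f (u i) := by
  rw [integral_finsetSum_measure]
  · refine Finset.sum_congr rfl fun i _ ↦ ?_
    rw [integral_smul_measure, integral_dirac, ENNReal.toReal_ofReal (hw i)]
  · exact fun i _ ↦ (integrable_dirac (by simp)).smul_measure (by simp)

instance isFiniteMeasure_sum_dirac {ι : Type*} [Fintype ι] (w u : ι → ℝ) :
    IsFiniteMeasure (∑ i, ENNReal.ofReal (w i) • Measure.dirac (u i)) := by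
  refine ⟨?_⟩
  simp [Measure.finsetSum_apply, ENNReal.sum_lt_top]

lemma charFun_sum_dirac {ι : Type*} [Fintype ι] (w u : ι → ℝ) (hw : ∀ i, 0 ≤ w i) (t : ℝ) :
    charFun (∑ i, ENNReal.ofReal (w i) • Measure.dirac (u i)) t
      = ∑ i, (w i : ℂ) * Complex.exp (t * u i * Complex.I) := by
  rw [charFun_apply_real, integral_sum_dirac w u hw]
  simp

lemma analyticOnNhd_trigSum {ι : Type*} [Fintype ι] (w u : ι → ℝ) :
    AnalyticOnNhd ℝ (fun t : ℝ ↦ ∑ i, (w i : ℂ) * Complex.exp (t * u i * Complex.I)) Set.univ := by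
  intro t _
  have h : AnalyticAt ℝ (fun t : ℝ ↦ (t : ℂ)) t := Complex.ofRealCLM.analyticAt t
  have hexp : ∀ z : ℂ, AnalyticAt ℝ Complex.exp z := fun z ↦
    (Complex.differentiable_exp.analyticAt z).restrictScalars
  fun_prop

/-- Trigonometric sums with nonnegative coefficients that agree near the origin give the same mass
to each point. -/
lemma sum_ite_eq_of_trigSum_eventuallyEq {ι κ : Type*} [Fintype ι] [Fintype κ]
    {w u : ι → ℝ} {w' u' : κ → ℝ} (hw : ∀ i, 0 ≤ w i) (hw' : ∀ i, 0 ≤ w' i)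
    (h : (fun t : ℝ ↦ ∑ i, (w i : ℂ) * Complex.exp (t * u i * Complex.I)) =ᶠ[𝓝 0]
      fun t : ℝ ↦ ∑ i, (w' i : ℂ) * Complex.exp (t * u' i * Complex.I)) (x : ℝ) :
    ∑ i, w i * (if u i = x then 1 else 0) = ∑ i, w' i * (if u' i = x then 1 else 0) := by
  have heq := (analyticOnNhd_trigSum w u).eq_of_eventuallyEq (analyticOnNhd_trigSum w' u') h
  have hM : (∑ i, ENNReal.ofReal (w i) • Measure.dirac (u i))
      = ∑ i, ENNReal.ofReal (w' i) • Measure.dirac (u' i) := by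
    refine Measure.ext_of_charFun (funext fun t ↦ ?_)
    rw [charFun_sum_dirac w u hw, charFun_sum_dirac w' u' hw']
    exact congrFun heq t
  have := integral_sum_dirac w u hw (fun y ↦ if y = x then (1 : ℝ) else 0)
  rw [hM, integral_sum_dirac w' u' hw'] at this
  exact this.symm

instance isFiniteMeasure_delta {k : ℕ} (θ : (Fin k → ℝ) × (Fin k → ℝ)) :
    IsFiniteMeasure (Delta θ) :=
  isFiniteMeasure_sum_dirac _ _

lemma charFun_delta {k : ℕ} {θ : (Fin k → ℝ) × (Fin k → ℝ)} (hθ : θ ∈ Omega k) (t : ℝ) :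
    charFun (Delta θ) t = ∑ j, (θ.1 j : ℂ) * Complex.exp (t * θ.2 j * Complex.I) :=
  charFun_sum_dirac _ _ hθ.1 t

lemma charFun_mixture {k : ℕ} (θ : (Fin k → ℝ) × (Fin k → ℝ)) {G : Measure ℝ}
    (hG : G ∈ ZeroSymmetric) (t : ℝ) :
    charFun (mixture θ G) t = charFun G t * charFun (Delta θ) t := by
  have := hG.1
  exact charFun_conv t

lemma conj_charFun_of_zeroSymmetric {G : Measure ℝ} (hG : G ∈ ZeroSymmetric) (t : ℝ) :
    (starRingEnd ℂ) (charFun G t) = charFun G t := by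
  have h := charFun_map_mul (μ := G) (-1) t
  simp only [neg_one_mul] at h
  rw [hG.2, charFun_neg] at h
  exact h.symm

lemma continuous_charFun_of_zeroSymmetric {G : Measure ℝ} (hG : G ∈ ZeroSymmetric) :
    Continuous (charFun G) := by
  have := hG.1
  fun_prop

lemma eventually_charFun_ne_zero {G : Measure ℝ} (hG : G ∈ ZeroSymmetric) :
    ∀ᶠ t in 𝓝 0, charFun G t ≠ 0 := by
  have := hG.1
  exact (continuous_charFun_of_zeroSymmetric hG).continuousAt.eventually_ne (by simp)

/-- Two mixtures of symmetric distributions coincide only if their mixing distributions are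
balanced. -/
theorem crossBalanced_of_mixture_eq {k l : ℕ} {θ : (Fin k → ℝ) × (Fin k → ℝ)}
    {η : (Fin l → ℝ) × (Fin l → ℝ)} {G H : Measure ℝ} (hθ : θ ∈ Omega k) (hη : η ∈ Omega l)
    (hG : G ∈ ZeroSymmetric) (hH : H ∈ ZeroSymmetric) (h : mixture θ G = mixture η H) :
    CrossBalanced θ.1 θ.2 η.1 η.2 := by
  have hconj : ∀ᶠ t in 𝓝 (0 : ℝ), charFun (Delta θ) t * charFun (Delta η) (-t)
      = charFun (Delta θ) (-t) * charFun (Delta η) t := by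
    filter_upwards [eventually_charFun_ne_zero hG, eventually_charFun_ne_zero hH] with t hg hh
    have e : charFun G t * charFun (Delta θ) t = charFun H t * charFun (Delta η) t := by
      rw [← charFun_mixture θ hG, ← charFun_mixture η hH, h]
    have e' := congrArg (starRingEnd ℂ) e
    rw [map_mul, map_mul, conj_charFun_of_zeroSymmetric hG, conj_charFun_of_zeroSymmetric hH] at e'
    rw [charFun_neg, charFun_neg]
    -- Cross-multiplying `e` with its conjugate `e'` eliminates the real factors coming from `G` and
    -- `H`.
    refine mul_left_cancel₀ (mul_ne_zero hg hh) ?_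
    linear_combination (charFun H t * (starRingEnd ℂ) (charFun (Delta η) t)) * e -
      (charFun H t * charFun (Delta η) t) * e'
  intro x
  -- The two trigonometric sums have the same coefficients and opposite frequencies: they belong to
  -- `P ⋆ Q⁻` and its reflection.
  have key := sum_ite_eq_of_trigSum_eventuallyEq
    (w := fun ij : Fin k × Fin l ↦ θ.1 ij.1 * η.1 ij.2) (u := fun ij ↦ θ.2 ij.1 - η.2 ij.2)
    (w' := fun ij : Fin k × Fin l ↦ θ.1 ij.1 * η.1 ij.2) (u' := fun ij ↦ -(θ.2 ij.1 - η.2 ij.2))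
    (fun _ ↦ mul_nonneg (hθ.1 _) (hη.1 _)) (fun _ ↦ mul_nonneg (hθ.1 _) (hη.1 _)) ?_ x
  · rw [← sub_eq_zero, ← Finset.sum_sub_distrib] at key
    rw [← Fintype.sum_prod_type']
    rw [← key]
    refine Finset.sum_congr rfl fun ij _ ↦ ?_
    simp only [oddIndicator]
    ring
  · filter_upwards [hconj] with t ht
    simp only [charFun_delta hθ, charFun_delta hη, Finset.sum_mul_sum,
      ← Fintype.sum_prod_type'] at ht
    convert ht using 2 with ij _ ij _
    · push_cast
      rw [mul_mul_mul_comm, ← Complex.exp_add]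
      congr 2
      ring
    · push_cast
      rw [mul_mul_mul_comm, ← Complex.exp_add]
      congr 2
      ring

/-- The symmetric component is determined by the mixture and the mixing distribution. -/
theorem zeroSymmetric_eq_of_mixture_eq {k : ℕ} {θ : (Fin k → ℝ) × (Fin k → ℝ)} {G H : Measure ℝ}
    (hθ : θ ∈ Omega k) (hG : G ∈ ZeroSymmetric) (hH : H ∈ ZeroSymmetric)
    (h : mixture θ G = mixture θ H) : G = H := by
  have := hG.1
  have := hH.1
  have han : AnalyticOnNhd ℝ (charFun (Delta θ)) Set.univ := by
    rw [show charFun (Delta θ) = _ from funext (charFun_delta hθ)]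
    exact analyticOnNhd_trigSum θ.1 θ.2
  have h0 : charFun (Delta θ) 0 = 1 := by
    rw [charFun_delta hθ]
    simp [← Complex.ofReal_sum, hθ.2.1]
  -- An analytic function equal to 1 at the origin has isolated zeros; continuity of `charFun G` and
  -- `charFun H` then fills in the values there.
  have hne : ∀ t, ∀ᶠ s in 𝓝[≠] t, charFun (Delta θ) s ≠ 0 := by
    intro t
    refine (han t trivial).eventually_eq_zero_or_eventually_ne_zero.resolve_left fun hz ↦ ?_
    have := han.eqOn_zero_of_preconnected_of_eventuallyEq_zero isPreconnected_univ trivial hz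
      (Set.mem_univ 0)
    rw [h0] at this
    exact one_ne_zero this
  refine Measure.ext_of_charFun (funext fun t ↦ ?_)
  have hev : charFun G =ᶠ[𝓝[≠] t] charFun H := by
    filter_upwards [hne t] with s hs
    refine mul_right_cancel₀ hs ?_
    rw [← charFun_mixture θ hG, ← charFun_mixture θ hH, h]
  refine tendsto_nhds_unique (l := 𝓝[≠] t)
    (((continuous_charFun_of_zeroSymmetric hG).tendsto t).mono_left nhdsWithin_le_nhds) ?_
  exact (((continuous_charFun_of_zeroSymmetric hH).tendsto t).mono_left
    nhdsWithin_le_nhds).congr' hev.symm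

/-! ### Identifiability and the null exceptional set -/

theorem mem_omegaStar_three {l m : Fin 3 → ℝ} (h : (l, m) ∈ Omega 3) (hl : l 0 * l 1 * l 2 ≠ 0)
    (hr : (m 1 - m 0) / (m 2 - m 1) ∉ ({1 / 3, 1 / 2, 1, 2, 3} : Set ℝ)) :
    (l, m) ∈ OmegaStar 3 := by
  refine ⟨h, fun G hG ↦ ⟨((l, m), G), Set.eq_singleton_iff_unique_mem.2 ⟨⟨h, hG, rfl⟩, ?_⟩⟩⟩
  rintro ⟨⟨q, n⟩, H⟩ ⟨hqn, hH, heq⟩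
  have hpos : ∀ i, 0 < l i := by
    intro i
    refine (h.1 i).lt_of_ne' fun e ↦ hl ?_
    dsimp only at e
    fin_cases i <;> simp_all
  obtain ⟨rfl, rfl⟩ :=
    (crossBalanced_of_mixture_eq h hqn hG hH heq.symm).eq h hpos hr hqn
  exact congrArg (Prod.mk _) (zeroSymmetric_eq_of_mixture_eq h hH hG heq)

lemma addHaar_hyperplane {E : Type*} [NormedAddCommGroup E] [NormedSpace ℝ E] [MeasurableSpace E]
    [BorelSpace E] [FiniteDimensional ℝ E] (μ : Measure E) [μ.IsAddHaarMeasure]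
    (L : E →ₗ[ℝ] ℝ) (c : ℝ) (hL : L ≠ 0) : μ {x | L x = c} = 0 := by
  obtain ⟨v, hv⟩ : ∃ v, L v ≠ 0 := by
    by_contra! h
    exact hL (LinearMap.ext h)
  set S : AffineSubspace ℝ E := AffineSubspace.mk' ((c / L v) • v) (LinearMap.ker L)
  have hS : {x | L x = c} = (S : Set E) := by
    ext x
    simp [S, AffineSubspace.mem_mk', div_mul_cancel₀ _ hv, sub_eq_zero]
  rw [hS]
  refine Measure.addHaar_affineSubspace μ S fun htop ↦ hv ?_
  have h1 : v + (c / L v) • v ∈ S := htop ▸ AffineSubspace.mem_top ℝ E _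
  simpa [S, AffineSubspace.mem_mk'] using h1

theorem volume_omega_diff_omegaStar_three :
    volume {x : (Fin 2 → ℝ) × (Fin 3 → ℝ) | ofCoords x ∈ Omega 3 \ OmegaStar 3} = 0 := by
  have : (volume : Measure ((Fin 2 → ℝ) × (Fin 3 → ℝ))).IsAddHaarMeasure :=
    Measure.prod.instIsAddHaarMeasure volume volume
  let fstProj (i : Fin 2) : ((Fin 2 → ℝ) × (Fin 3 → ℝ)) →ₗ[ℝ] ℝ :=
    (LinearMap.proj i).comp (LinearMap.fst ℝ _ _)
  let sndProj (i : Fin 3) : ((Fin 2 → ℝ) × (Fin 3 → ℝ)) →ₗ[ℝ] ℝ :=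
    (LinearMap.proj i).comp (LinearMap.snd ℝ _ _)
  let gap (r : ℝ) := (sndProj 1 - sndProj 0) - r • (sndProj 2 - sndProj 1)
  have hgap (r : ℝ) : gap r ≠ 0 := by
    intro h
    have := LinearMap.congr_fun h (0, ![-1, 0, 0])
    simp [gap, sndProj] at this
  have hfst (i : Fin 2) : fstProj i ≠ 0 := by
    intro h
    have := LinearMap.congr_fun h (1, 0)
    simp [fstProj] at this
  have hsum : fstProj 0 + fstProj 1 ≠ 0 := by
    intro h
    have := LinearMap.congr_fun h (1, 0)
    simp [fstProj] at this
  -- The exceptional hyperplanes: a vanishing weight (`λ₃ = 0` reads `λ₁ + λ₂ = 1`), or a gap ratio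
  -- equal to one of the five values.
  have hnull : volume ((({x | fstProj 0 x = 0} ∪ {x | fstProj 1 x = 0})
      ∪ {x | (fstProj 0 + fstProj 1) x = 1})
      ∪ ⋃ r ∈ ({1 / 3, 1 / 2, 1, 2, 3} : Set ℝ), {x | gap r x = 0}) = 0 := by
    refine measure_union_null (measure_union_null (measure_union_null ?_ ?_) ?_) ?_
    · exact addHaar_hyperplane _ _ _ (hfst 0)
    · exact addHaar_hyperplane _ _ _ (hfst 1)
    · exact addHaar_hyperplane _ _ _ hsum
    · exact (measure_biUnion_null_iff (Set.toFinite _).countable).2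
        fun r _ ↦ addHaar_hyperplane _ _ _ (hgap r)
  refine measure_mono_null ?_ hnull
  rintro x ⟨hx, hx'⟩
  by_contra hmem
  simp only [Set.mem_union, Set.mem_ofPred_eq, Set.mem_iUnion, not_or, not_exists] at hmem
  obtain ⟨⟨⟨h0, h1⟩, h2⟩, h3⟩ := hmem
  refine hx' (mem_omegaStar_three hx ?_ ?_)
  · have e0 : (Fin.snoc (α := fun _ => ℝ) x.1 (1 - ∑ j, x.1 j) : Fin 3 → ℝ) 0 = x.1 0 := rfl
    have e1 : (Fin.snoc (α := fun _ => ℝ) x.1 (1 - ∑ j, x.1 j) : Fin 3 → ℝ) 1 = x.1 1 := rfl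
    have e2 : (Fin.snoc (α := fun _ => ℝ) x.1 (1 - ∑ j, x.1 j) : Fin 3 → ℝ) 2
        = 1 - (x.1 0 + x.1 1) := by
      rw [← Fin.sum_univ_two]
      rfl
    rw [e0, e1, e2]
    refine mul_ne_zero (mul_ne_zero h0 h1) fun e ↦ h2 ?_
    simp only [fstProj, LinearMap.add_apply, LinearMap.comp_apply, LinearMap.fst_apply,
      LinearMap.proj_apply]
    linarith
  · intro hr
    refine h3 _ hr ?_
    have hlt : x.2 1 < x.2 2 := hx.2.2 (show (1 : Fin 3) < 2 by decide)
    have hne : x.2 2 - x.2 1 ≠ 0 := by linarith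
    simp [gap, sndProj, div_mul_cancel₀ _ hne]

end SymMix

theorem corollary1 :
    (∀ l m : Fin 3 → ℝ, (l, m) ∈ SymMix.Omega 3 →
      l 0 * l 1 * l 2 ≠ 0 →
      (m 1 - m 0) / (m 2 - m 1) ∉ ({1 / 3, 1 / 2, 1, 2, 3} : Set ℝ) →
      (l, m) ∈ SymMix.OmegaStar 3) ∧
    volume {x : (Fin 2 → ℝ) × (Fin 3 → ℝ) |
      SymMix.ofCoords x ∈ SymMix.Omega 3 \ SymMix.OmegaStar 3} = 0 :=
  ⟨fun _ _ ↦ SymMix.mem_omegaStar_three, SymMix.volume_omega_diff_omegaStar_three⟩
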